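/- Let $K$ be a field, $d\ge 0$ an integer, and $L=(\ell_1,\dots,\ell_d)$ integers with every $\ell_i\ge 1$. Let $Q$ be the grid quiver of shape $L$: its vertices are the integer points of $[0,\ell_1]\times\cdots\times[0,\ell_d]$, and there is a unique edge $p\to q$ whenever $q-p$ is a standard basis vector, and no other edge. All representations of $Q$ are finite-dimensional over $K$. For a central charge $\alpha:Q_0\to\mathbb R$, the slope of a nonzero representation $V$ is $$\mu_\alpha(V)=\frac{\sum_{x}\alpha(x)\dim V_x}{\sum_{x}\dim V_x},$$ and a nonzero representation $V$ is $\alpha$-semistable if $\mu_\alpha(V')\le\mu_\alpha(V)$ for every nonzero subrepresentation $V'\subseteq V$. The Harder–Narasimhan (HN) filtration of $V$ along $\alpha$ is the unique filtration $0=V^0\subsetneq V^1\subsetneq\cdots\subsetneq V^n=V$ whose quotients $S^i=V^i/V^{i-1}$ are $\alpha$-semistable with $\mu_\alpha(S^1)>\cdots>\mu_\alpha(S^n)$, and the HN type of $V$ along $\alpha$ is the tuple of dimension vectors $(\underline{\dim}_{S^1},\dots,\underline{\dim}_{S^n})$ (the empty tuple for $V=0$). For a rectangle $R=[a_1,b_1]\times\cdots\times[a_d,b_d]$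 with integers $0\le a_i\le b_i\le\ell_i$, the rectangle representation $\mathbf I[R]$ is $K$ at the vertices in $R$ and $0$ at the others, with identity maps along the edges inside $R$ and zero maps along all other edges. Let $\mathbf{Rep}_{\mathrm{rec}}(Q)$ be the full subcategory of those representations that are isomorphic to finite direct sums of rectangle representations, and let $\mathcal H$ be the set of all $\alpha:Q_0\to\mathbb R$ with $\mu_\alpha(\mathbf I[R])=\mu_\alpha(\mathbf I[R'])$ for some two distinct rectangles $R\ne R'$. **Theorem.** Let $\alpha:Q_0\to\mathbb R$ be a central charge with $\alpha\notin\mathcal H$. Then $\alpha$ is complete on $\mathbf{Rep}_{\mathrm{rec}}(Q)$, i.e. any two objects of $\mathbf{Rep}_{\mathrm{rec}}(Q)$ with the same HN type along $\alpha$ are isomorphic, if and only if $\alpha(s(e))>\alpha(t(e))$ for every edge $e$ of $Q$, where $s(e)$ and $t(e)$ are the source and the target of $e$. -/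

import Mathlib

universe u v w

/-! ### Finite-dimensional representations of a quiver -/

/-- A finite-dimensional representation over `K` of the quiver `Q`: a finite-dimensional vector
space at each vertex and a linear map along each edge. -/
structure QuiverRep (K : Type u) [Field K] (Q : Type w) [Quiver.{v} Q] where
  obj : Q → Type u
  [addCommGroup : ∀ x, AddCommGroup (obj x)]
  [module : ∀ x, Module K (obj x)]
  [finite : ∀ x, Module.Finite K (obj x)]
  map : ∀ {x y : Q}, (x ⟶ y) → (obj x →ₗ[K] obj y)

attribute [instance] QuiverRep.addCommGroup QuiverRep.module QuiverRep.finite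

namespace QuiverRep

section General

variable {K : Type u} [Field K] {Q : Type w} [Quiver.{v} Q]

/-- Two representations are isomorphic: there are linear isomorphisms at all vertices which
commute with the maps along all edges. -/
def IsIsomorphic (V W : QuiverRep K Q) : Prop :=
  ∃ φ : ∀ x, V.obj x ≃ₗ[K] W.obj x,
    ∀ (x y : Q) (e : x ⟶ y) (v : V.obj x), φ y (V.map e v) = W.map e (φ x v)

/-- The direct sum of a finite family of representations, computed vertex by vertex. -/
def directSum {n : ℕ} (V : Fin n → QuiverRep K Q) : QuiverRep K Q where
  obj x := ∀ i, (V i).obj x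
  map e := LinearMap.pi fun i => (V i).map e ∘ₗ LinearMap.proj i

/-- The dimension vector. -/
noncomputable def dimVec (V : QuiverRep K Q) : Q → ℕ := fun x => Module.finrank K (V.obj x)

/-- A representation is nonzero if one of its vector spaces is. -/
def IsNonzero (V : QuiverRep K Q) : Prop := ∃ x, Nontrivial (V.obj x)

/-- A subrepresentation: a subspace at each vertex, preserved by the maps along the edges. -/
@[ext]
structure Sub (V : QuiverRep K Q) where
  carrier : ∀ x, Submodule K (V.obj x)
  map_mem : ∀ {x y : Q} (e : x ⟶ y) (v : V.obj x), v ∈ carrier x → V.map e v ∈ carrier y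

/-- A subrepresentation, seen as a representation. -/
def Sub.toRep {V : QuiverRep K Q} (A : Sub V) : QuiverRep K Q where
  obj x := A.carrier x
  map {x y} e := (V.map e).restrict (p := A.carrier x) (q := A.carrier y) (A.map_mem e)

/-- The quotient of a representation by a subrepresentation. -/
def quotient (V : QuiverRep K Q) (A : Sub V) : QuiverRep K Q where
  obj x := V.obj x ⧸ A.carrier x
  map {x y} e := (A.carrier x).mapQ (A.carrier y) (V.map e) (A.map_mem e)

/-- The intersection `A ∩ B`, seen as a subrepresentation of `B`. When `A ⊆ B` this is just `A`. -/
def Sub.within {V : QuiverRep K Q} (A B : Sub V) : Sub B.toRep where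
  carrier x := (A.carrier x).comap (B.carrier x).subtype
  map_mem e v hv := A.map_mem e v.1 hv

/-- The quotient `B / A` for subrepresentations `A ⊆ B` of `V`. -/
def Sub.subquotient {V : QuiverRep K Q} (A B : Sub V) : QuiverRep K Q :=
  B.toRep.quotient (A.within B)

/-! ### Slopes, semistability and Harder-Narasimhan types -/

variable [Fintype Q]

/-- The `α`-slope of a (nonzero) representation. -/
noncomputable def slope (α : Q → ℝ) (V : QuiverRep K Q) : ℝ :=
  (∑ x, α x * (V.dimVec x : ℝ)) / (∑ x, (V.dimVec x : ℝ))

/-- `V` is `α`-semistable: it is nonzero, and no nonzero subrepresentation has a larger slope. -/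
def IsSemistable (α : Q → ℝ) (V : QuiverRep K Q) : Prop :=
  V.IsNonzero ∧ ∀ A : Sub V, A.toRep.IsNonzero → A.toRep.slope α ≤ V.slope α

/-- A Harder-Narasimhan filtration of `V` along `α`: a filtration
`0 = V⁰ ⊂ V¹ ⊂ ⋯ ⊂ Vⁿ = V` with `α`-semistable (in particular nonzero) successive quotients
of strictly decreasing slopes. The zero representation has the one of length `0`. -/
structure HNFiltration (α : Q → ℝ) (V : QuiverRep K Q) where
  length : ℕ
  step : Fin (length + 1) → Sub V
  step_zero : ∀ x, (step 0).carrier x = ⊥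
  step_last : ∀ x, (step (Fin.last length)).carrier x = ⊤
  step_le : ∀ (i : Fin length) (x : Q), (step i.castSucc).carrier x ≤ (step i.succ).carrier x
  semistable : ∀ i : Fin length, ((step i.castSucc).subquotient (step i.succ)).IsSemistable α
  slope_lt : ∀ i j : Fin length, i < j →
    ((step j.castSucc).subquotient (step j.succ)).slope α <
      ((step i.castSucc).subquotient (step i.succ)).slope α

/-- The list of dimension vectors of the successive quotients of a filtration. -/
noncomputable def HNFiltration.type {α : Q → ℝ} {V : QuiverRep K Q} (F : HNFiltration α V) :
    List (Q → ℕ) :=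
  List.ofFn fun i : Fin F.length => ((F.step i.castSucc).subquotient (F.step i.succ)).dimVec

open Classical in
/-- The Harder-Narasimhan type of `V` along `α`: the list of dimension vectors of the successive
quotients of the Harder-Narasimhan filtration (every representation has exactly one such
filtration, so the choice is no choice and the second case does not occur). -/
noncomputable def hnType (α : Q → ℝ) (V : QuiverRep K Q) : List (Q → ℕ) :=
  if h : Nonempty (HNFiltration α V) then h.some.type else []

/-- A collection `A` of central charges is complete on the full subcategory with the set of
objects `C`: objects with the same Harder-Narasimhan types along all `α ∈ A` are isomorphic. -/
def IsComplete (A : Set (Q → ℝ)) (C : Set (QuiverRep K Q)) : Prop :=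
  ∀ V ∈ C, ∀ W ∈ C, (∀ α ∈ A, V.hnType α = W.hnType α) → V.IsIsomorphic W

end General

section Indicator

variable (K : Type u) [Field K] {Q : Type w} [Quiver.{v} Q]

open Classical in
/-- The representation `I[P]` of a set `P` of vertices. Its space at `x` is the space of functions
from the proofs of `x ∈ P` to `K`, hence a copy of `K` if `x ∈ P` and zero otherwise.
Its maps are the identity of `K` on edges with both ends in `P` and zero on the other edges. -/
noncomputable def indicator (P : Set Q) : QuiverRep K Q where
  obj x := PLift (x ∈ P) → K
  map {x y} _ :=
    { toFun := fun f _ => if hx : x ∈ P then f ⟨hx⟩ else 0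
      map_add' := fun f g => by
        funext h
        by_cases hx : x ∈ P <;> simp [hx]
      map_smul' := fun c f => by
        funext h
        by_cases hx : x ∈ P <;> simp [hx] }

end Indicator

end QuiverRep

/-! ### Grid quivers and rectangles -/

/-- The vertices of the grid quiver of shape `ℓ = (ℓ₁, …, ℓ_d)`: the integer points of
`[0, ℓ₁] × ⋯ × [0, ℓ_d]`. -/
def Grid {d : ℕ} (ℓ : Fin d → ℕ) : Type := ∀ i, Fin (ℓ i + 1)

namespace Grid

section Vertices

variable {d : ℕ} {ℓ : Fin d → ℕ}

instance : Fintype (Grid ℓ) := inferInstanceAs (Fintype (∀ i, Fin (ℓ i + 1)))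

/-- There is a unique edge from `p` to `q` if `q - p` is a standard basis vector, and there is no
edge otherwise. -/
instance : Quiver.{0} (Grid ℓ) where
  Hom p q := PLift (∃ i, (q i : ℕ) = (p i : ℕ) + 1 ∧ ∀ j, j ≠ i → q j = p j)

/-- A rectangle `[a₁, b₁] × ⋯ × [a_d, b_d]`, with `aᵢ ≤ bᵢ` for all `i`, inside the grid. -/
def IsRectangle (R : Set (Grid ℓ)) : Prop :=
  ∃ a b : Grid ℓ, (∀ i, a i ≤ b i) ∧ R = {p | ∀ i, a i ≤ p i ∧ p i ≤ b i}

end Vertices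

section Representations

variable (K : Type u) [Field K] {d : ℕ} (ℓ : Fin d → ℕ)

/-- The rectangle-decomposable representations: those isomorphic to a finite direct sum of
rectangle representations `I[R]`. -/
def rectangleDecomposable : Set (QuiverRep K (Grid ℓ)) :=
  {V | ∃ (n : ℕ) (R : Fin n → Set (Grid ℓ)), (∀ i, IsRectangle (R i)) ∧
    V.IsIsomorphic (QuiverRep.directSum fun i => QuiverRep.indicator K (R i))}

/-- The union of the hyperplanes of central charges for which the rectangle representations of
two distinct rectangles have the same slope. -/
def hyperplanes : Set (Grid ℓ → ℝ) :=
  {α | ∃ R R' : Set (Grid ℓ), IsRectangle R ∧ IsRectangle R' ∧ R ≠ R' ∧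
    (QuiverRep.indicator K R).slope α = (QuiverRep.indicator K R').slope α}

end Representations

end Grid

/-!
Write `excess α θ` for `∑ x, (α x - θ) * dim x`. It is modular on the lattice of subrepresentations,
and the steps of a Harder-Narasimhan filtration are exactly the least maximizers of `excess α θ`
for varying `θ`. So the filtration is unique, and that of a direct sum of semistable representations
collects the summands by slope. If moreover distinct summands have distinct slopes, then their
multiplicities can be read off from the type.

The sets of vertices of rectangles are convex sublattices, and on a subrepresentation of such an
indicator the dimension is monotone. Along an antitone `α`, semistability is thus the negative
correlation of an antitone and a monotone function on a finite distributive lattice, an instance of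
the Fortuin-Kasteleyn-Ginibre inequality. Conversely, if `α p < α q` for an edge `p ⟶ q`, then
`I[{p, q}]` and `I[{p}] ⊕ I[{q}]` both have the type of the filtration through the part at `q`.
-/

/-- `w` is a modular function (a valuation) on the lattice `L`. -/
def IsModularFunction {L R : Type*} [Lattice L] [Add R] (w : L → R) : Prop :=
  ∀ a b, w (a ⊔ b) + w (a ⊓ b) = w a + w b

namespace IsModularFunction

variable {L R : Type*} [Lattice L] [AddCommMonoid R] [PartialOrder R]
  [IsOrderedCancelAddMonoid R] {w : L → R} {a b : L}

theorem apply_inf_le_apply_inf (hw : IsModularFunction w) (hab : a ≤ b)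
    (h : ∀ c ∈ Set.Icc a b, w c ≤ w a) (y : L) : w (y ⊓ b) ≤ w (y ⊓ a) := by
  have hmod := hw (y ⊓ b) a
  rw [inf_assoc, inf_eq_right.2 hab] at hmod
  have hle := h (y ⊓ b ⊔ a) ⟨le_sup_right, sup_le inf_le_right hab⟩
  exact le_of_add_le_add_right (hmod.symm.trans_le
    ((add_le_add_left hle _).trans_eq (add_comm _ _)))

theorem le_sup_or_apply_sup_lt_apply_sup (hw : IsModularFunction w) (hab : a ≤ b)
    (h : ∀ c ∈ Set.Icc a b, c ≠ b → w c < w b) (y : L) :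
    b ≤ y ⊔ a ∨ w (y ⊔ a) < w (y ⊔ b) := by
  refine or_iff_not_imp_left.2 fun hb => ?_
  have hmod := hw (y ⊔ a) b
  rw [sup_assoc, sup_eq_right.2 hab] at hmod
  have hlt := h ((y ⊔ a) ⊓ b) ⟨le_inf le_sup_right hab, inf_le_right⟩ (mt inf_eq_right.1 hb)
  exact lt_of_add_lt_add_right (hmod.symm.trans_lt (add_lt_add_right hlt _))

variable [BoundedOrder L] {n : ℕ} {f : Fin (n + 1) → L} {i : Fin (n + 1)}

theorem le_or_apply_lt_apply_sup (hw : IsModularFunction w) (hf : Monotone f) (hbot : f 0 = ⊥)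
    (hlow : ∀ j : Fin n, j.castSucc < i →
      ∀ c ∈ Set.Icc (f j.castSucc) (f j.succ), c ≠ f j.succ → w c < w (f j.succ)) (y : L) :
    f i ≤ y ∨ w y < w (y ⊔ f i) := by
  induction i using Fin.induction with
  | zero => exact .inl (hbot.trans_le bot_le)
  | succ k ih =>
    have hk := k.castSucc_lt_succ
    rcases hw.le_sup_or_apply_sup_lt_apply_sup (hf hk.le) (hlow k hk) y with hle | hlt <;>
      rcases ih fun j hj => hlow j (hj.trans hk) with hle' | hlt'
    · exact .inl (hle.trans_eq (sup_eq_left.2 hle'))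
    · exact .inr (hlt'.trans_eq
        (congrArg w (le_antisymm (sup_le_sup_left (hf hk.le) y) (sup_le le_sup_left hle))))
    · exact .inr ((congrArg w (sup_eq_left.2 hle')).symm.trans_lt hlt)
    · exact .inr (hlt'.trans hlt)

theorem apply_le_apply_inf (hw : IsModularFunction w) (hf : Monotone f) (htop : f (Fin.last n) = ⊤)
    (hhigh : ∀ j : Fin n, i ≤ j.castSucc →
      ∀ c ∈ Set.Icc (f j.castSucc) (f j.succ), w c ≤ w (f j.castSucc)) (y : L) :
    w y ≤ w (y ⊓ f i) := by
  induction i using Fin.reverseInduction with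
  | last => rw [htop, inf_top_eq]
  | cast k ih =>
    have hk := k.castSucc_lt_succ
    exact (ih fun j hj => hhigh j (hk.le.trans hj)).trans
      (hw.apply_inf_le_apply_inf (hf hk.le) (hhigh k le_rfl) y)

/-- `f i` dominates every `y` because `y` may first be cut down to `y ⊓ f i`, then completed to
`f i`, with `w` growing both times; the second time strictly, unless `y` contains `f i`. -/
theorem isLeast_maximizers (hw : IsModularFunction w) (hf : Monotone f) (hbot : f 0 = ⊥)
    (htop : f (Fin.last n) = ⊤)
    (hlow : ∀ j : Fin n, j.castSucc < i →
      ∀ c ∈ Set.Icc (f j.castSucc) (f j.succ), c ≠ f j.succ → w c < w (f j.succ))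
    (hhigh : ∀ j : Fin n, i ≤ j.castSucc →
      ∀ c ∈ Set.Icc (f j.castSucc) (f j.succ), w c ≤ w (f j.castSucc)) :
    IsLeast {a | ∀ y, w y ≤ w a} (f i) := by
  refine ⟨fun y => ?_, fun a ha => ?_⟩
  · refine (hw.apply_le_apply_inf hf htop hhigh y).trans ?_
    rcases hw.le_or_apply_lt_apply_sup hf hbot hlow (y ⊓ f i) with hle | hlt
    · rw [inf_eq_right.2 (le_inf_iff.1 hle).1]
    · rw [sup_eq_right.2 inf_le_right] at hlt
      exact hlt.le
  · exact (hw.le_or_apply_lt_apply_sup hf hbot hlow a).resolve_right (ha _).not_gt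

end IsModularFunction

theorem card_mul_sum_mul_le_of_antitone_of_monotone {X R : Type*} [DistribLattice X] [Fintype X]
    [CommRing R] [LinearOrder R] [IsStrictOrderedRing R] {f g : X → R} (hf : Antitone f)
    (hg : Monotone g) : Fintype.card X * ∑ x, f x * g x ≤ (∑ x, f x) * ∑ x, g x := by
  obtain ⟨C, hC⟩ := (Set.finite_range f).bddAbove
  obtain ⟨c, hc⟩ := (Set.finite_range g).bddBelow
  have hfkg := fkg (μ := 1) (f := fun x => C - f x) (g := fun x => g x - c) zero_le_one
    (fun x => sub_nonneg.2 (hC ⟨x, rfl⟩)) (fun x => sub_nonneg.2 (hc ⟨x, rfl⟩))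
    (fun x y hxy => sub_le_sub_left (hf hxy) C) (fun x y hxy => sub_le_sub_right (hg hxy) c)
    (fun _ _ => le_rfl)
  simp only [Pi.one_apply, one_mul, sub_mul, mul_sub, Finset.sum_sub_distrib, Finset.sum_const,
    Finset.card_univ, ← Finset.mul_sum, ← Finset.sum_mul, nsmul_eq_mul, mul_one] at hfkg
  linarith

namespace QuiverRep

section Subrepresentations

variable {K : Type u} [Field K] {Q : Type w} [Quiver.{v} Q] {V : QuiverRep K Q}

theorem finrank_map_add_finrank_inf_ker {M N : Type*} [AddCommGroup M] [Module K M]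
    [Module.Finite K M] [AddCommGroup N] [Module K N] (f : M →ₗ[K] N) (p : Submodule K M) :
    Module.finrank K (p.map f) + Module.finrank K (p ⊓ LinearMap.ker f : Submodule K M) =
      Module.finrank K p := by
  have hrank := LinearMap.finrank_range_add_finrank_ker (f.domRestrict p)
  rw [LinearMap.range_domRestrict, LinearMap.ker_domRestrict,
    ← Submodule.finrank_map_subtype_eq, Submodule.map_comap_subtype] at hrank
  exact hrank

theorem isNonzero_iff_dimVec_ne_zero : V.IsNonzero ↔ V.dimVec ≠ 0 :=
  (exists_congr fun _ => Module.finrank_pos_iff.symm.trans Nat.pos_iff_ne_zero).trans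
    Function.ne_iff.symm

namespace Sub

instance : PartialOrder (Sub V) := PartialOrder.lift carrier fun _ _ => Sub.ext

instance : Lattice (Sub V) where
  sup A B :=
    { carrier := A.carrier ⊔ B.carrier
      map_mem := fun e v hv => by
        obtain ⟨a, ha, b, hb, rfl⟩ := Submodule.mem_sup.1 hv
        rw [map_add]
        exact Submodule.add_mem_sup (A.map_mem e a ha) (B.map_mem e b hb) }
  inf A B :=
    { carrier := A.carrier ⊓ B.carrier
      map_mem := fun e v hv => ⟨A.map_mem e v hv.1, B.map_mem e v hv.2⟩ }
  le_sup_left _ _ := le_sup_left (α := ∀ x, Submodule K (V.obj x))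
  le_sup_right _ _ := le_sup_right (α := ∀ x, Submodule K (V.obj x))
  sup_le _ _ _ := sup_le (α := ∀ x, Submodule K (V.obj x))
  inf_le_left _ _ := inf_le_left (α := ∀ x, Submodule K (V.obj x))
  inf_le_right _ _ := inf_le_right (α := ∀ x, Submodule K (V.obj x))
  le_inf _ _ _ := le_inf (α := ∀ x, Submodule K (V.obj x))

instance : BoundedOrder (Sub V) where
  top := ⟨⊤, fun _ _ _ => Submodule.mem_top⟩
  le_top _ := le_top (α := ∀ x, Submodule K (V.obj x))
  bot := ⟨⊥, fun e v hv => by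
    rw [(Submodule.mem_bot K).1 hv, map_zero]
    exact Submodule.zero_mem _⟩
  bot_le _ := bot_le (α := ∀ x, Submodule K (V.obj x))

theorem dimVec_mono : Monotone fun A : Sub V => A.toRep.dimVec :=
  fun _ _ h x => Submodule.finrank_mono (h x)

theorem eq_of_le_of_dimVec_eq {A B : Sub V} (h : A ≤ B) (h' : A.toRep.dimVec = B.toRep.dimVec) :
    A = B :=
  Sub.ext (funext fun x => Submodule.eq_of_le_of_finrank_eq (h x) (congrFun h' x))

theorem dimVec_strictMono : StrictMono fun A : Sub V => A.toRep.dimVec :=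
  fun _ _ h => (dimVec_mono h.le).lt_of_ne (mt (eq_of_le_of_dimVec_eq h.le) h.ne)

theorem dimVec_bot : (⊥ : Sub V).toRep.dimVec = 0 :=
  funext fun x => finrank_bot K (V.obj x)

theorem dimVec_top : (⊤ : Sub V).toRep.dimVec = V.dimVec :=
  funext fun x => finrank_top K (V.obj x)

theorem dimVec_le (A : Sub V) : A.toRep.dimVec ≤ V.dimVec :=
  fun _ => Submodule.finrank_le _

theorem dimVec_sup_add_dimVec_inf (A B : Sub V) :
    (A ⊔ B).toRep.dimVec + (A ⊓ B).toRep.dimVec = A.toRep.dimVec + B.toRep.dimVec :=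
  funext fun _ => Submodule.finrank_sup_add_finrank_inf_eq _ _

theorem dimVec_within {A B : Sub V} (h : A ≤ B) :
    (A.within B).toRep.dimVec = A.toRep.dimVec :=
  funext fun x => (Submodule.comapSubtypeEquivOfLe (h x)).finrank_eq

/-- A subrepresentation of the subrepresentation `B` of `V`, seen as a subrepresentation of `V`. -/
def ofWithin (B : Sub V) (D : Sub B.toRep) : Sub V where
  carrier x := (D.carrier x).map (B.carrier x).subtype
  map_mem e v hv := by
    obtain ⟨c, hc, rfl⟩ := hv
    exact ⟨B.toRep.map e c, D.map_mem e c hc, rfl⟩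

theorem ofWithin_le (B : Sub V) (D : Sub B.toRep) : B.ofWithin D ≤ B :=
  fun x => Submodule.map_subtype_le _ (D.carrier x)

theorem le_ofWithin {A B : Sub V} (h : A ≤ B) {D : Sub B.toRep} (hD : A.within B ≤ D) :
    A ≤ B.ofWithin D :=
  fun x a ha => ⟨⟨a, h x ha⟩, hD x ha, rfl⟩

theorem dimVec_ofWithin (B : Sub V) (D : Sub B.toRep) :
    (B.ofWithin D).toRep.dimVec = D.toRep.dimVec :=
  funext fun x => Submodule.finrank_map_subtype_eq _ (D.carrier x)

/-- The image `C / A` of `C` in the quotient `V / A`. -/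
def mapQuotient (A C : Sub V) : Sub (V.quotient A) where
  carrier x := (C.carrier x).map (A.carrier x).mkQ
  map_mem e v hv := by
    obtain ⟨c, hc, rfl⟩ := hv
    exact ⟨V.map e c, C.map_mem e c hc, rfl⟩

/-- The preimage in `V` of a subrepresentation of the quotient `V / A`. -/
def comapQuotient (A : Sub V) (D : Sub (V.quotient A)) : Sub V where
  carrier x := (D.carrier x).comap (A.carrier x).mkQ
  map_mem e _ hv := D.map_mem e _ hv

theorem le_comapQuotient (A : Sub V) (D : Sub (V.quotient A)) : A ≤ A.comapQuotient D :=
  fun x => Submodule.le_comap_mkQ (A.carrier x) (D.carrier x)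

theorem mapQuotient_comapQuotient (A : Sub V) (D : Sub (V.quotient A)) :
    A.mapQuotient (A.comapQuotient D) = D :=
  Sub.ext (funext fun x =>
    Submodule.map_comap_eq_of_surjective (A.carrier x).mkQ_surjective (D.carrier x))

theorem dimVec_quotient_add (A : Sub V) :
    (V.quotient A).dimVec + A.toRep.dimVec = V.dimVec :=
  funext fun x => (A.carrier x).finrank_quotient_add_finrank

theorem dimVec_mapQuotient_add {A C : Sub V} (h : A ≤ C) :
    (A.mapQuotient C).toRep.dimVec + A.toRep.dimVec = C.toRep.dimVec := by
  funext x
  have hrank := finrank_map_add_finrank_inf_ker (A.carrier x).mkQ (C.carrier x)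
  rw [Submodule.ker_mkQ, inf_eq_right.2 (h x)] at hrank
  exact hrank

theorem dimVec_add_eq_dimVec_comapQuotient (A : Sub V) (D : Sub (V.quotient A)) :
    D.toRep.dimVec + A.toRep.dimVec = (A.comapQuotient D).toRep.dimVec := by
  rw [← dimVec_mapQuotient_add (A.le_comapQuotient D), mapQuotient_comapQuotient]

theorem dimVec_subquotient_add {A B : Sub V} (h : A ≤ B) :
    (A.subquotient B).dimVec + A.toRep.dimVec = B.toRep.dimVec := by
  rw [← dimVec_within h]
  exact (A.within B).dimVec_quotient_add

theorem isNonzero_subquotient_iff {A B : Sub V} (h : A ≤ B) :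
    (A.subquotient B).IsNonzero ↔ A ≠ B := by
  rw [isNonzero_iff_dimVec_ne_zero, not_iff_not, ← add_eq_right (b := A.toRep.dimVec),
    dimVec_subquotient_add h]
  exact ⟨fun h' => eq_of_le_of_dimVec_eq h h'.symm, fun h' => h' ▸ rfl⟩

theorem exists_sub_subquotient_iff {A B : Sub V} (h : A ≤ B) {δ : Q → ℕ} :
    (∃ D : Sub (A.subquotient B), D.toRep.dimVec = δ) ↔
      ∃ C ∈ Set.Icc A B, δ + A.toRep.dimVec = C.toRep.dimVec := by
  rw [← dimVec_within h]
  constructor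
  · rintro ⟨D, rfl⟩
    exact ⟨B.ofWithin ((A.within B).comapQuotient D),
      ⟨le_ofWithin h ((A.within B).le_comapQuotient D), ofWithin_le _ _⟩,
      (dimVec_add_eq_dimVec_comapQuotient _ D).trans (dimVec_ofWithin _ _).symm⟩
  · rintro ⟨C, ⟨hAC, hCB⟩, hδ⟩
    have hC : A.within B ≤ C.within B := fun x v hv => hAC x hv
    rw [← dimVec_within hCB, ← dimVec_mapQuotient_add hC, add_left_inj] at hδ
    exact ⟨(A.within B).mapQuotient (C.within B), hδ.symm⟩

end Sub

end Subrepresentations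

section Slopes

variable {Q : Type w} [Fintype Q]

/-- The degree along `α` of a dimension vector, normalized so that it vanishes on the
representations of slope `θ`. -/
noncomputable def excess (α : Q → ℝ) (θ : ℝ) : (Q → ℕ) →+ ℝ where
  toFun δ := ∑ x, (α x - θ) * δ x
  map_zero' := by simp
  map_add' δ ε := by simp [mul_add, Finset.sum_add_distrib]

theorem excess_apply (α : Q → ℝ) (θ : ℝ) (δ : Q → ℕ) :
    excess α θ δ = ∑ x, (α x - θ) * δ x := rfl

theorem excess_eq_add (α : Q → ℝ) (θ μ : ℝ) (δ : Q → ℕ) :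
    excess α θ δ = excess α μ δ + (μ - θ) * ∑ x, (δ x : ℝ) := by
  rw [excess_apply, excess_apply, Finset.mul_sum, ← Finset.sum_add_distrib]
  exact Finset.sum_congr rfl fun x _ => by ring

variable {K : Type u} [Field K] [Quiver.{v} Q] {V : QuiverRep K Q} {α : Q → ℝ} {θ : ℝ}

theorem IsNonzero.sum_dimVec_pos (h : V.IsNonzero) : 0 < ∑ x, (V.dimVec x : ℝ) := by
  obtain ⟨x, hx⟩ := Function.ne_iff.1 (isNonzero_iff_dimVec_ne_zero.1 h)
  exact Finset.sum_pos' (fun _ _ => Nat.cast_nonneg _)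
    ⟨x, Finset.mem_univ x, Nat.cast_pos.2 (Nat.pos_of_ne_zero hx)⟩

theorem excess_dimVec_eq_sub (α : Q → ℝ) (θ : ℝ) (V : QuiverRep K Q) :
    excess α θ V.dimVec = ∑ x, α x * V.dimVec x - θ * ∑ x, (V.dimVec x : ℝ) := by
  rw [excess_eq_add α θ 0, excess_apply]
  simp only [sub_zero, zero_sub, neg_mul, ← sub_eq_add_neg]

theorem IsNonzero.slope_le_iff (h : V.IsNonzero) :
    V.slope α ≤ θ ↔ excess α θ V.dimVec ≤ 0 := by
  rw [slope, div_le_iff₀ h.sum_dimVec_pos, excess_dimVec_eq_sub, sub_nonpos]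

theorem IsNonzero.slope_eq_iff (h : V.IsNonzero) :
    V.slope α = θ ↔ excess α θ V.dimVec = 0 := by
  rw [slope, div_eq_iff h.sum_dimVec_pos.ne', excess_dimVec_eq_sub, sub_eq_zero]

theorem isSemistable_and_slope_eq_iff :
    V.IsSemistable α ∧ V.slope α = θ ↔
      V.IsNonzero ∧ excess α θ V.dimVec = 0 ∧ ∀ D : Sub V, excess α θ D.toRep.dimVec ≤ 0 := by
  constructor
  · rintro ⟨⟨hV, hle⟩, rfl⟩
    refine ⟨hV, hV.slope_eq_iff.1 rfl, fun D => ?_⟩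
    by_cases hD : D.toRep.IsNonzero
    · exact hD.slope_le_iff.1 (hle D hD)
    · rw [not_not.1 (mt isNonzero_iff_dimVec_ne_zero.2 hD), map_zero]
  · rintro ⟨hV, heq, hle⟩
    have hslope := hV.slope_eq_iff.2 heq
    exact ⟨⟨hV, fun D hD => hslope ▸ hD.slope_le_iff.2 (hle D)⟩, hslope⟩

namespace Sub

variable {A B C : Sub V}

theorem isModularFunction_excess (α : Q → ℝ) (θ : ℝ) :
    IsModularFunction fun A : Sub V => excess α θ A.toRep.dimVec := fun A B => by
  rw [← map_add, ← map_add, dimVec_sup_add_dimVec_inf]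

theorem isSemistable_subquotient_and_slope_eq_iff (h : A ≤ B) :
    (A.subquotient B).IsSemistable α ∧ (A.subquotient B).slope α = θ ↔
      A ≠ B ∧ excess α θ A.toRep.dimVec = excess α θ B.toRep.dimVec ∧
        ∀ C ∈ Set.Icc A B, excess α θ C.toRep.dimVec ≤ excess α θ A.toRep.dimVec := by
  rw [isSemistable_and_slope_eq_iff, isNonzero_subquotient_iff h]
  refine and_congr_right' (and_congr ?_ ⟨fun hle C hC => ?_, fun hle D => ?_⟩)
  · rw [← dimVec_subquotient_add h, map_add, right_eq_add]
  · obtain ⟨δ, hδ⟩ : ∃ δ, C.toRep.dimVec = δ + A.toRep.dimVec :=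
      ⟨_, (tsub_add_cancel_of_le (dimVec_mono hC.1)).symm⟩
    obtain ⟨D, rfl⟩ := (exists_sub_subquotient_iff h).2 ⟨C, hC, hδ.symm⟩
    rw [hδ, map_add, add_le_iff_nonpos_left]
    exact hle D
  · obtain ⟨C, hC, hδ⟩ := (exists_sub_subquotient_iff h).1 ⟨D, rfl⟩
    rw [← add_le_iff_nonpos_left, ← map_add, hδ]
    exact hle C hC

theorem sum_dimVec_strictMono : StrictMono fun A : Sub V => ∑ x, (A.toRep.dimVec x : ℝ) :=
  fun A B h => by
    have hlt : ∑ x, A.toRep.dimVec x < ∑ x, B.toRep.dimVec x :=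
      Fintype.sum_strictMono (dimVec_strictMono h)
    simpa only [← Nat.cast_sum, Nat.cast_lt] using hlt

end Sub

end Slopes

section Isomorphisms

variable {K : Type u} [Field K] {Q : Type w} [Quiver.{v} Q] {U V W : QuiverRep K Q}

theorem IsIsomorphic.refl (V : QuiverRep K Q) : V.IsIsomorphic V :=
  ⟨fun _ => LinearEquiv.refl K _, fun _ _ _ _ => rfl⟩

theorem IsIsomorphic.symm (h : V.IsIsomorphic W) : W.IsIsomorphic V := by
  obtain ⟨φ, hφ⟩ := h
  refine ⟨fun x => (φ x).symm, fun x y e w => ?_⟩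
  rw [LinearEquiv.symm_apply_eq, hφ, LinearEquiv.apply_symm_apply]

theorem IsIsomorphic.trans (h : U.IsIsomorphic V)
    (h' : V.IsIsomorphic W) : U.IsIsomorphic W := by
  obtain ⟨φ, hφ⟩ := h
  obtain ⟨ψ, hψ⟩ := h'
  refine ⟨fun x => (φ x).trans (ψ x), fun x y e w => ?_⟩
  rw [LinearEquiv.trans_apply, LinearEquiv.trans_apply, hφ, hψ]

theorem IsIsomorphic.exists_orderIso_sub (h : V.IsIsomorphic W) :
    ∃ e : Sub V ≃o Sub W, ∀ A, (e A).toRep.dimVec = A.toRep.dimVec := by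
  obtain ⟨φ, hφ⟩ := h
  let push (A : Sub V) : Sub W :=
    { carrier := fun x => (A.carrier x).map (φ x).toLinearMap
      map_mem := by
        rintro x y e _ ⟨v, hv, rfl⟩
        exact ⟨V.map e v, A.map_mem e v hv, hφ x y e v⟩ }
  let pull (B : Sub W) : Sub V :=
    { carrier := fun x => (B.carrier x).comap (φ x).toLinearMap
      map_mem := fun {x y} e v hv => by
        rw [Submodule.mem_comap, LinearEquiv.coe_coe, hφ]
        exact B.map_mem e _ hv }
  refine ⟨⟨⟨push, pull, fun A => ?_, fun B => ?_⟩, fun {A B} => ?_⟩, fun A => ?_⟩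
  · exact Sub.ext (funext fun x => Submodule.comap_map_eq_of_injective (φ x).injective _)
  · exact Sub.ext (funext fun x => Submodule.map_comap_eq_of_surjective (φ x).surjective _)
  · exact forall_congr' fun x => Submodule.map_le_map_iff_of_injective (φ x).injective _ _
  · exact funext fun x => LinearEquiv.finrank_map_eq (φ x) (A.carrier x)

end Isomorphisms

section HarderNarasimhan

variable {K : Type u} [Field K] {Q : Type w} [Quiver.{v} Q] [Fintype Q] {V W : QuiverRep K Q}
  {α : Q → ℝ}

namespace HNFiltration

/-- The slope of a successive quotient of a Harder-Narasimhan filtration. -/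
noncomputable def slopeAt (F : HNFiltration α V) (i : Fin F.length) : ℝ :=
  ((F.step i.castSucc).subquotient (F.step i.succ)).slope α

variable (F : HNFiltration α V)

theorem strictAnti_slopeAt : StrictAnti F.slopeAt :=
  fun i j => F.slope_lt i j

theorem step_castSucc_le_step_succ (i : Fin F.length) : F.step i.castSucc ≤ F.step i.succ :=
  F.step_le i

theorem strictMono_step : StrictMono F.step :=
  Fin.strictMono_iff_lt_succ.2 fun i => (F.step_castSucc_le_step_succ i).lt_of_ne
    ((Sub.isNonzero_subquotient_iff (F.step_castSucc_le_step_succ i)).1 (F.semistable i).1)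

/-- The index `i` separates the slopes larger than `θ` from the others. -/
def IsCut (θ : ℝ) (i : Fin (F.length + 1)) : Prop :=
  ∀ j : Fin F.length, j.castSucc < i ↔ θ < F.slopeAt j

theorem exists_isCut (θ : ℝ) : ∃ i, F.IsCut θ i := by
  obtain ⟨i, hi, hmin⟩ := wellFounded_lt.has_min
    {i : Fin (F.length + 1) | ∀ j : Fin F.length, i ≤ j.castSucc → F.slopeAt j ≤ θ}
    ⟨Fin.last _, fun j hj => absurd hj j.castSucc_lt_last.not_ge⟩
  refine ⟨i, fun j => ⟨fun hj => ?_, fun hj => lt_of_not_ge fun hij => (hi j hij).not_gt hj⟩⟩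
  by_contra! hle
  exact hmin j.castSucc (fun k hk => (F.strictAnti_slopeAt.antitone hk).trans hle) hj

theorem exists_isCut_at (i : Fin (F.length + 1)) : ∃ θ, F.IsCut θ i := by
  induction i using Fin.lastCases with
  | last =>
    obtain ⟨m, hm⟩ := (Set.finite_range F.slopeAt).bddBelow
    exact ⟨m - 1, fun j => iff_of_true j.castSucc_lt_last
      ((sub_one_lt m).trans_le (hm (Set.mem_range_self j)))⟩
  | cast i => exact ⟨F.slopeAt i, fun j => F.strictAnti_slopeAt.lt_iff_gt.symm⟩

variable {F}

theorem IsCut.isLeast_maximizers {θ : ℝ} {i : Fin (F.length + 1)} (h : F.IsCut θ i) :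
    IsLeast {A : Sub V | ∀ B : Sub V, excess α θ B.toRep.dimVec ≤ excess α θ A.toRep.dimVec}
      (F.step i) := by
  have hmax (j) := ((Sub.isSemistable_subquotient_and_slope_eq_iff
    (F.step_castSucc_le_step_succ j)).1 ⟨F.semistable j, rfl⟩).2
  refine (Sub.isModularFunction_excess α θ).isLeast_maximizers F.strictMono_step.monotone
    (Sub.ext (funext F.step_zero)) (Sub.ext (funext F.step_last))
    (fun j hj C hC hne => ?_) (fun j hj C hC => ?_)
  · rw [excess_eq_add α θ (F.slopeAt j), excess_eq_add α θ (F.slopeAt j)]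
    exact add_lt_add_of_le_of_lt (((hmax j).2 C hC).trans_eq (hmax j).1)
      (mul_lt_mul_of_pos_left (Sub.sum_dimVec_strictMono (hC.2.lt_of_ne hne))
        (sub_pos.2 ((h j).1 hj)))
  · rw [excess_eq_add α θ (F.slopeAt j), excess_eq_add α θ (F.slopeAt j)]
    exact add_le_add ((hmax j).2 C hC) (mul_le_mul_of_nonpos_left
      (Sub.sum_dimVec_strictMono.monotone hC.1)
      (sub_nonpos.2 (not_lt.1 (mt (h j).2 hj.not_gt))))

theorem range_step_eq (F : HNFiltration α V) : Set.range F.step = {A | ∃ θ, IsLeast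
    {B : Sub V | ∀ C : Sub V, excess α θ C.toRep.dimVec ≤ excess α θ B.toRep.dimVec} A} := by
  ext A
  constructor
  · rintro ⟨i, rfl⟩
    obtain ⟨θ, hi⟩ := F.exists_isCut_at i
    exact ⟨θ, hi.isLeast_maximizers⟩
  · rintro ⟨θ, hA⟩
    obtain ⟨i, hi⟩ := F.exists_isCut θ
    exact ⟨i, hi.isLeast_maximizers.unique hA⟩

instance : Subsingleton (HNFiltration α V) := ⟨fun F G => by
  have hrange : Set.range F.step = Set.range G.step := F.range_step_eq.trans G.range_step_eq.symm
  have hF := F.strictMono_step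
  have hG := G.strictMono_step
  have hlength : F.length = G.length := by
    have hcard := congrArg Set.ncard hrange
    rw [Set.ncard_range_of_injective hF.injective, Set.ncard_range_of_injective hG.injective]
      at hcard
    simpa using hcard
  obtain ⟨n, s, _, _, _, _, _⟩ := F
  obtain ⟨m, t, _, _, _, _, _⟩ := G
  obtain rfl : n = m := hlength
  obtain rfl : s = t := (hF.range_inj hG).1 hrange
  rfl⟩

theorem hnType_eq_type (F : HNFiltration α V) : V.hnType α = F.type := by
  have h : Nonempty (HNFiltration α V) := ⟨F⟩
  rw [hnType, dif_pos h, Subsingleton.elim h.some F]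

theorem exists_type_eq {n : ℕ} {step : Fin (n + 1) → Sub V} {s : Fin n → ℝ} (hbot : step 0 = ⊥)
    (htop : step (Fin.last n) = ⊤) (hle : ∀ i : Fin n, step i.castSucc ≤ step i.succ)
    (hs : StrictAnti s)
    (h : ∀ i : Fin n, ((step i.castSucc).subquotient (step i.succ)).IsSemistable α ∧
      ((step i.castSucc).subquotient (step i.succ)).slope α = s i) :
    ∃ F : HNFiltration α V,
      F.type = List.ofFn fun i : Fin n => ((step i.castSucc).subquotient (step i.succ)).dimVec :=
  ⟨{ length := n
     step := step
     step_zero := congrFun (congrArg Sub.carrier hbot)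
     step_last := congrFun (congrArg Sub.carrier htop)
     step_le := hle
     semistable := fun i => (h i).1
     slope_lt := fun i j hij => by rw [(h i).2, (h j).2]; exact hs hij }, rfl⟩

end HNFiltration

theorem IsIsomorphic.exists_type_eq (h : V.IsIsomorphic W)
    (F : HNFiltration α V) : ∃ G : HNFiltration α W, G.type = F.type := by
  obtain ⟨e, he⟩ := h.exists_orderIso_sub
  have hle (i) := F.step_castSucc_le_step_succ i
  have hle' (i) := e.monotone (hle i)
  have hdim (i) : ((e (F.step (Fin.castSucc i))).subquotient (e (F.step i.succ))).dimVec =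
      ((F.step i.castSucc).subquotient (F.step i.succ)).dimVec := by
    rw [← add_left_inj (F.step i.castSucc).toRep.dimVec, Sub.dimVec_subquotient_add (hle i),
      ← he, Sub.dimVec_subquotient_add (hle' i), he]
  obtain ⟨G, hG⟩ := HNFiltration.exists_type_eq (V := W) (step := fun i => e (F.step i))
    (by rw [Sub.ext (funext F.step_zero : (F.step 0).carrier = (⊥ : Sub V).carrier), map_bot])
    (by rw [Sub.ext (funext F.step_last : _ = (⊤ : Sub V).carrier), map_top])
    hle' F.strictAnti_slopeAt (α := α) fun i => by
      obtain ⟨hne, heq, hmax⟩ := (Sub.isSemistable_subquotient_and_slope_eq_iff (hle i)).1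
        ⟨F.semistable i, rfl⟩
      refine (Sub.isSemistable_subquotient_and_slope_eq_iff (hle' i)).2
        ⟨e.injective.ne hne, by rwa [he, he], fun C hC => ?_⟩
      rw [← e.apply_symm_apply C, he, he]
      exact hmax _ ⟨(e.le_symm_apply).2 hC.1, (e.symm_apply_le).2 hC.2⟩
  exact ⟨G, hG.trans (congrArg List.ofFn (funext hdim))⟩

theorem IsIsomorphic.hnType_eq (h : V.IsIsomorphic W) (α : Q → ℝ) :
    V.hnType α = W.hnType α := by
  by_cases hV : Nonempty (HNFiltration α V)
  · obtain ⟨F⟩ := hV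
    obtain ⟨G, hG⟩ := h.exists_type_eq F
    rw [F.hnType_eq_type, G.hnType_eq_type, hG]
  · have hW : ¬Nonempty (HNFiltration α W) := fun ⟨G⟩ => hV ⟨(h.symm.exists_type_eq G).choose⟩
    rw [hnType, hnType, dif_neg hV, dif_neg hW]

end HarderNarasimhan

section DirectSums

variable {K : Type u} [Field K] {Q : Type w} [Quiver.{v} Q] {n : ℕ} {W : Fin n → QuiverRep K Q}

theorem directSum_comp_isIsomorphic {m : ℕ} (W : Fin m → QuiverRep K Q) (σ : Fin n ≃ Fin m) :
    (directSum (W ∘ σ)).IsIsomorphic (directSum W) :=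
  .symm ⟨fun x => (LinearEquiv.piCongrLeft' K (fun j => (W j).obj x) σ.symm), fun _ _ _ _ => rfl⟩

theorem isIsomorphic_directSum_const (V : QuiverRep K Q) :
    V.IsIsomorphic (directSum fun _ : Fin 1 => V) :=
  ⟨fun x => (LinearEquiv.funUnique (Fin 1) K (V.obj x)).symm, fun _ _ _ _ => rfl⟩

theorem dimVec_directSum (W : Fin n → QuiverRep K Q) :
    (directSum W).dimVec = ∑ j, (W j).dimVec :=
  funext fun x => (Module.finrank_pi_fintype K).trans
    (Finset.sum_apply x Finset.univ fun j => (W j).dimVec).symm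

/-- The partial direct sum of the `W j` with `j ∈ J`, as a subrepresentation of the whole one. -/
def summands (W : Fin n → QuiverRep K Q) (J : Finset (Fin n)) : Sub (directSum W) where
  carrier _ := Submodule.pi (↑J)ᶜ fun _ => ⊥
  map_mem e v hv j hj := by
    have hvj : v j = 0 := hv j hj
    change (W j).map e (v j) = 0
    rw [hvj, map_zero]

/-- The projection to `W j` of a subrepresentation of the direct sum. -/
def projection (j : Fin n) (A : Sub (directSum W)) : Sub (W j) where
  carrier x := (A.carrier x).map (LinearMap.proj j)
  map_mem e v hv := by
    obtain ⟨a, ha, rfl⟩ := hv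
    exact ⟨(directSum W).map e a, A.map_mem e a ha, rfl⟩

theorem mem_summands {J : Finset (Fin n)} {x : Q} {v : (directSum W).obj x} :
    v ∈ (summands W J).carrier x ↔ ∀ j ∉ J, v j = 0 := Iff.rfl

theorem summands_univ : summands W Finset.univ = ⊤ :=
  Sub.ext (funext fun _ => eq_top_iff.2 fun _ _ j hj => absurd (Finset.mem_univ j) hj)

theorem summands_empty : summands W ∅ = ⊥ :=
  Sub.ext (funext fun _ => eq_bot_iff.2 fun _ hv => funext fun j => hv j (Finset.notMem_empty j))

theorem summands_mono : Monotone (summands W) :=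
  fun _ _ h _ _ hv j hj => hv j fun hjI => hj (h hjI)

theorem summands_inf (I J : Finset (Fin n)) :
    summands W I ⊓ summands W J = summands W (I ∩ J) := by
  refine le_antisymm (fun x v hv j hj => ?_) (le_inf (summands_mono Finset.inter_subset_left)
    (summands_mono Finset.inter_subset_right))
  by_cases hjI : j ∈ I
  · exact hv.2 j fun hjJ => hj (Finset.mem_inter.2 ⟨hjI, hjJ⟩)
  · exact hv.1 j hjI

theorem dimVec_projection_add (j : Fin n) (A : Sub (directSum W)) :
    (projection j A).toRep.dimVec + (A ⊓ summands W {j}ᶜ).toRep.dimVec = A.toRep.dimVec := by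
  funext x
  let π : (∀ k, (W k).obj x) →ₗ[K] (W j).obj x := LinearMap.proj j
  have hker : (summands W {j}ᶜ).carrier x = LinearMap.ker π :=
    Submodule.ext fun v => by
      simp only [mem_summands, Finset.mem_compl, Finset.mem_singleton, not_not, forall_eq]
      rfl
  have hrank := finrank_map_add_finrank_inf_ker π (A.carrier x)
  rw [← hker] at hrank
  exact hrank

theorem projection_summands {j : Fin n} {J : Finset (Fin n)} (hj : j ∈ J) :
    projection j (summands W J) = ⊤ := by
  refine Sub.ext (funext fun x => eq_top_iff.2 fun v _ => ?_)
  refine ⟨(Pi.single j v : ∀ k, (W k).obj x), fun k hk => ?_,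
    Pi.single_eq_same (M := fun k => (W k).obj x) j v⟩
  exact Pi.single_eq_of_ne (M := fun k => (W k).obj x) (ne_of_mem_of_not_mem hj hk).symm v

theorem dimVec_summands (J : Finset (Fin n)) :
    (summands W J).toRep.dimVec = ∑ j ∈ J, (W j).dimVec := by
  induction J using Finset.induction with
  | empty => rw [summands_empty, Sub.dimVec_bot, Finset.sum_empty]
  | insert j J hj ih =>
    rw [Finset.sum_insert hj, ← ih, ← dimVec_projection_add j,
      projection_summands (Finset.mem_insert_self j J), Sub.dimVec_top, summands_inf,
      ← Finset.sdiff_eq_inter_compl, ← Finset.erase_eq, Finset.erase_insert hj]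

theorem dimVec_subquotient_summands {I J : Finset (Fin n)} (h : I ⊆ J) :
    ((summands W I).subquotient (summands W J)).dimVec = ∑ j ∈ J \ I, (W j).dimVec := by
  rw [← add_left_inj (summands W I).toRep.dimVec, Sub.dimVec_subquotient_add (summands_mono h),
    dimVec_summands, dimVec_summands, Finset.sum_sdiff h]

variable [Fintype Q] {α : Q → ℝ} {θ : ℝ}

theorem excess_le_excess_inf_summands_compl {T : Finset (Fin n)}
    (h : ∀ j ∈ T, (W j).IsSemistable α ∧ (W j).slope α = θ) (A : Sub (directSum W)) :
    excess α θ A.toRep.dimVec ≤ excess α θ (A ⊓ summands W Tᶜ).toRep.dimVec := by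
  induction T using Finset.induction with
  | empty => rw [Finset.compl_empty, summands_univ, inf_top_eq]
  | insert j T _ ih =>
    have hj := (isSemistable_and_slope_eq_iff.1 (h j (Finset.mem_insert_self j T))).2.2
    refine (ih fun k hk => h k (Finset.mem_insert_of_mem hk)).trans ?_
    rw [Finset.compl_insert, Finset.erase_eq, Finset.sdiff_eq_inter_compl, ← summands_inf,
      ← inf_assoc, ← dimVec_projection_add j (A ⊓ summands W Tᶜ), map_add]
    exact add_le_of_nonpos_left (hj _)

theorem isSemistable_subquotient_summands {I J : Finset (Fin n)} (hIJ : I ⊂ J)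
    (h : ∀ j ∈ J \ I, (W j).IsSemistable α ∧ (W j).slope α = θ) :
    ((summands W I).subquotient (summands W J)).IsSemistable α ∧
      ((summands W I).subquotient (summands W J)).slope α = θ := by
  have h' (j) (hj : j ∈ J \ I) := isSemistable_and_slope_eq_iff.1 (h j hj)
  refine (Sub.isSemistable_subquotient_and_slope_eq_iff (summands_mono hIJ.subset)).2
    ⟨?_, ?_, fun C hC => ?_⟩
  · obtain ⟨j, hj⟩ := Finset.sdiff_nonempty.2 hIJ.not_subset
    rw [← Sub.isNonzero_subquotient_iff (summands_mono hIJ.subset), isNonzero_iff_dimVec_ne_zero,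
      dimVec_subquotient_summands hIJ.subset, Ne, Finset.sum_eq_zero_iff]
    exact fun hzero => isNonzero_iff_dimVec_ne_zero.1 (h' j hj).1 (hzero j hj)
  · have hzero : excess α θ (∑ j ∈ J \ I, (W j).dimVec) = 0 :=
      (map_sum _ _ _).trans (Finset.sum_eq_zero fun j hj => (h' j hj).2.1)
    rw [dimVec_summands, dimVec_summands, ← Finset.sum_sdiff hIJ.subset, map_add, hzero, zero_add]
  · have hinf : C ⊓ summands W (J \ I)ᶜ = summands W I := by
      rw [← inf_eq_left.2 hC.2, inf_assoc, summands_inf, ← Finset.sdiff_eq_inter_compl,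
        Finset.sdiff_sdiff_eq_self hIJ.subset, inf_eq_right.2 hC.1]
    exact hinf ▸ excess_le_excess_inf_summands_compl h C

theorem hnType_directSum_of_strictAnti {m : ℕ} {s : Fin m → ℝ} (hs : StrictAnti s)
    {r : Fin n → Fin m} (hr : r.Surjective)
    (h : ∀ j, (W j).IsSemistable α ∧ (W j).slope α = s (r j)) :
    (directSum W).hnType α = List.ofFn fun i => ∑ j with r j = i, (W j).dimVec := by
  let J (i : Fin (m + 1)) : Finset (Fin n) := {j | (r j).castSucc < i}
  have hJ : Monotone J := fun a b hab j => by
    simpa [J] using fun hj => lt_of_lt_of_le hj hab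
  have hsdiff (i : Fin m) : J i.succ \ J i.castSucc = ({j | r j = i} : Finset (Fin n)) := by
    ext j
    simp only [J, Finset.mem_sdiff, Finset.mem_filter_univ, Fin.castSucc_lt_succ_iff,
      Fin.castSucc_lt_castSucc_iff, not_lt, le_antisymm_iff]
  have hlt (i : Fin m) : J i.castSucc ⊂ J i.succ := by
    obtain ⟨j, hj⟩ := hr i
    refine (hJ i.castSucc_lt_succ.le).ssubset_of_not_subset (Finset.sdiff_nonempty.1 ⟨j, ?_⟩)
    rw [hsdiff, Finset.mem_filter_univ, hj]
  obtain ⟨F, hF⟩ := HNFiltration.exists_type_eq (α := α) (step := fun i => summands W (J i))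
    (by simp [J, summands_empty]) (by simp [J, Fin.castSucc_lt_last, summands_univ])
    (fun i => summands_mono (hlt i).subset) hs fun i =>
      isSemistable_subquotient_summands (hlt i) fun j hj => by
        rw [hsdiff, Finset.mem_filter_univ] at hj
        exact hj ▸ h j
  rw [F.hnType_eq_type, hF]
  simp only [dimVec_subquotient_summands (hlt _).subset, hsdiff]

theorem hnType_directSum (h : ∀ j, (W j).IsSemistable α) :
    (directSum W).hnType α = ((Finset.univ.image fun j => (W j).slope α).sort (· ≥ ·)).map
      fun s => ∑ j with (W j).slope α = s, (W j).dimVec := by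
  set slopes := (Finset.univ.image fun j => (W j).slope α).sort (· ≥ ·) with hslopes
  have hmem (s : ℝ) : s ∈ slopes ↔ ∃ j, (W j).slope α = s := by simp [hslopes]
  have hanti : StrictAnti slopes.get := (Finset.sortedGT_sort _).strictAnti_get
  choose r hr using fun j => List.mem_iff_get.1 ((hmem _).2 ⟨j, rfl⟩)
  have hsurj : r.Surjective := fun i => by
    obtain ⟨j, hj⟩ := (hmem _).1 (slopes.get_mem i)
    exact ⟨j, hanti.injective ((hr j).trans hj)⟩
  rw [hnType_directSum_of_strictAnti hanti hsurj fun j => ⟨h j, (hr j).symm⟩]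
  conv_rhs => rw [← List.ofFn_get slopes, List.map_ofFn]
  simp only [Function.comp_def, ← hr, hanti.injective.eq_iff]

end DirectSums

section DistinctSlopes

variable {K : Type u} [Field K] {Q : Type w} [Quiver.{v} Q] [Fintype Q] {α : Q → ℝ}
  {ι : Type*} {V : ι → QuiverRep K Q} {n m : ℕ} {r : Fin n → ι} {s : Fin m → ι}

theorem eq_and_eq_of_nsmul_dimVec_eq (hV : ∀ i, (V i).IsNonzero)
    (hslope : Function.Injective fun i => (V i).slope α) {i j : ι} {k l : ℕ} (hl : l ≠ 0)
    (h : k • (V i).dimVec = l • (V j).dimVec) : i = j ∧ k = l := by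
  have hexcess : l • excess α ((V i).slope α) (V j).dimVec = 0 := by
    rw [← map_nsmul, ← h, map_nsmul, (hV i).slope_eq_iff.1 rfl, nsmul_zero]
  obtain rfl : i = j :=
    (hslope ((hV j).slope_eq_iff.2 ((smul_eq_zero.1 hexcess).resolve_left hl))).symm
  obtain ⟨x, hx⟩ := Function.ne_iff.1 (isNonzero_iff_dimVec_ne_zero.1 (hV i))
  exact ⟨rfl, Nat.eq_of_mul_eq_mul_right (Nat.pos_of_ne_zero hx) (congrFun h x)⟩

theorem nsmul_dimVec_mem_hnType_directSum_iff [DecidableEq ι] (hV : ∀ i, (V i).IsSemistable α)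
    (hslope : Function.Injective fun i => (V i).slope α) {i : ι} {k : ℕ} (hk : k ≠ 0) :
    k • (V i).dimVec ∈ (directSum fun j => V (r j)).hnType α ↔
      Fintype.card {j // r j = i} = k := by
  have hsum (j₀) : ∑ j with (V (r j)).slope α = (V (r j₀)).slope α, (V (r j)).dimVec =
      Fintype.card {j // r j = r j₀} • (V (r j₀)).dimVec := by
    rw [Fintype.card_subtype, ← Finset.sum_const]
    exact Finset.sum_congr (Finset.filter_congr fun j _ => hslope.eq_iff)
      fun j hj => by rw [(Finset.mem_filter_univ j).1 hj]
  rw [hnType_directSum fun j => hV (r j)]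
  simp only [List.mem_map, Finset.mem_sort, Finset.mem_image, Finset.mem_univ, true_and,
    exists_exists_eq_and, hsum]
  constructor
  · rintro ⟨j₀, hj₀⟩
    obtain ⟨rfl, h⟩ := eq_and_eq_of_nsmul_dimVec_eq (fun i => (hV i).1) hslope hk hj₀
    exact h
  · rintro rfl
    obtain ⟨j₀, rfl⟩ := Fintype.card_pos_iff.1 (Nat.pos_of_ne_zero hk)
    exact ⟨j₀, rfl⟩

theorem isIsomorphic_directSum_of_hnType_eq (hV : ∀ i, (V i).IsSemistable α)
    (hslope : Function.Injective fun i => (V i).slope α)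
    (h : (directSum fun j => V (r j)).hnType α = (directSum fun j => V (s j)).hnType α) :
    (directSum fun j => V (r j)).IsIsomorphic (directSum fun j => V (s j)) := by
  classical
  have hcard (i : ι) : Fintype.card {j // r j = i} = Fintype.card {j // s j = i} := by
    have hiff {k : ℕ} (hk : k ≠ 0) :
        Fintype.card {j // r j = i} = k ↔ Fintype.card {j // s j = i} = k := by
      rw [← nsmul_dimVec_mem_hnType_directSum_iff hV hslope hk, h,
        nsmul_dimVec_mem_hnType_directSum_iff hV hslope hk]
    by_contra hne
    rcases eq_or_ne (Fintype.card {j // r j = i}) 0 with hr | hr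
    · exact hne ((hiff fun hs => hne (hr.trans hs.symm)).2 rfl)
    · exact hne ((hiff hr).1 rfl).symm
  let σ : Fin n ≃ Fin m := Equiv.ofFiberEquiv fun i => Fintype.equivOfCardEq (hcard i)
  have hσ (j : Fin n) : s (σ j) = r j := Equiv.ofFiberEquiv_map _ j
  simp only [← hσ]
  exact directSum_comp_isIsomorphic (fun j => V (s j)) σ

end DistinctSlopes

section Indicators

variable {K : Type u} [Field K] {Q : Type w} [Quiver.{v} Q] {P : Set Q} {x y : Q}

theorem dimVec_indicator (P : Set Q) : (indicator K P).dimVec = P.indicator 1 := by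
  funext x
  change Module.finrank K (PLift (x ∈ P) → K) = _
  by_cases hx : x ∈ P
  · have : Unique (PLift (x ∈ P)) := ⟨⟨⟨hx⟩⟩, fun _ => rfl⟩
    rw [(LinearEquiv.funUnique _ K K).finrank_eq, Module.finrank_self, Set.indicator_of_mem hx,
      Pi.one_apply]
  · have : IsEmpty (PLift (x ∈ P)) := ⟨fun h => hx h.down⟩
    rw [Set.indicator_of_notMem hx, Module.finrank_zero_of_subsingleton]

theorem isNonzero_indicator_iff : (indicator K P).IsNonzero ↔ P.Nonempty := by
  rw [isNonzero_iff_dimVec_ne_zero, dimVec_indicator, Ne, Set.indicator_eq_zero',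
    Pi.one_def, Function.support_const one_ne_zero, Set.univ_disjoint, Set.nonempty_iff_ne_empty]

theorem indicator_map_injective (e : x ⟶ y) (hy : y ∈ P) :
    Function.Injective ((indicator K P).map e) := by
  classical
  refine (injective_iff_map_eq_zero _).2 fun f hf => funext fun ⟨hx⟩ => ?_
  have hfx : (if hx : x ∈ P then f ⟨hx⟩ else 0) = (0 : K) := congrFun hf ⟨hy⟩
  rwa [dif_pos hx] at hfx

theorem indicator_map_eq_zero (e : x ⟶ y) (h : x ∉ P ∨ y ∉ P) : (indicator K P).map e = 0 := by
  classical
  refine LinearMap.ext fun f => funext fun ⟨hy⟩ => ?_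
  exact dif_neg (h.resolve_right (not_not_intro hy))

theorem Sub.dimVec_le_of_map_injective {V : QuiverRep K Q} (D : Sub V) {e : x ⟶ y}
    (he : Function.Injective (V.map e)) : D.toRep.dimVec x ≤ D.toRep.dimVec y :=
  LinearMap.finrank_le_finrank_of_injective (f := D.toRep.map e)
    fun _ _ h => Subtype.ext (he (congrArg Subtype.val h))

theorem sum_mul_dimVec_sub_indicator {R : Type*} [Semiring R] [Fintype Q] [Fintype P] (f : Q → R)
    (D : Sub (indicator K P)) :
    ∑ x : P, f x * D.toRep.dimVec x = ∑ x, f x * (D.toRep.dimVec x : R) := by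
  refine Fintype.sum_of_injective _ Subtype.val_injective _ _ (fun x hx => ?_) fun _ => rfl
  have hle := D.dimVec_le x
  rw [dimVec_indicator, Set.indicator_of_notMem fun hxP => hx ⟨⟨x, hxP⟩, rfl⟩] at hle
  rw [Nat.le_zero.1 hle, Nat.cast_zero, mul_zero]

end Indicators

section Convexity

variable {K : Type u} [Field K] {Q : Type w} [Quiver.{v} Q]

theorem monotone_dimVec_sub_indicator [Finite Q] [PartialOrder Q]
    (hQ : ∀ x y : Q, x ⋖ y → Nonempty (x ⟶ y)) {P : Set Q} (hP : P.OrdConnected)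
    (D : Sub (indicator K P)) : Monotone fun x : P => D.toRep.dimVec x := by
  classical
  let _ : Fintype P := Fintype.ofFinite P
  let _ : LocallyFiniteOrder P := Fintype.toLocallyFiniteOrder
  refine (monotone_iff_forall_covBy _).2 fun x y hxy => ?_
  have hcov : (x : Q) ⋖ y := (Set.OrdConnected.apply_covBy_apply_iff
    (OrderEmbedding.subtype (· ∈ P)) (Subtype.range_coe.symm ▸ hP)).2 hxy
  obtain ⟨e⟩ := hQ x y hcov
  exact D.dimVec_le_of_map_injective (indicator_map_injective e y.2)

theorem isSemistable_indicator_of_antitone [Fintype Q] [DistribLattice Q]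
    (hQ : ∀ x y : Q, x ⋖ y → Nonempty (x ⟶ y)) {P : Sublattice Q} (hP : (P : Set Q).OrdConnected)
    (hne : (P : Set Q).Nonempty) {α : Q → ℝ} (hα : Antitone α) :
    (indicator K (P : Set Q)).IsSemistable α := by
  classical
  have hnz : (indicator K (P : Set Q)).IsNonzero := isNonzero_indicator_iff.2 hne
  obtain ⟨θ, hθ⟩ : ∃ θ, (indicator K (P : Set Q)).slope α = θ := ⟨_, rfl⟩
  have hexcess := hnz.slope_eq_iff.1 hθ
  refine (isSemistable_and_slope_eq_iff.2 ⟨hnz, hexcess, fun D => ?_⟩).1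
  have hsum : ∑ x : P, (α x - θ) = 0 := by
    rw [← hexcess, ← Sub.dimVec_top, excess_apply, ← sum_mul_dimVec_sub_indicator]
    refine Finset.sum_congr rfl fun x _ => ?_
    rw [Sub.dimVec_top, dimVec_indicator, Set.indicator_of_mem x.2, Pi.one_apply, Nat.cast_one,
      mul_one]
  have hharris := card_mul_sum_mul_le_of_antitone_of_monotone (X := P)
    (f := fun x => α x - θ) (g := fun x => (D.toRep.dimVec x : ℝ))
    (fun x y hxy => sub_le_sub_right (hα hxy) θ)
    (Nat.mono_cast.comp (monotone_dimVec_sub_indicator hQ hP D))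
  have hD : ∑ x : P, (α x - θ) * (D.toRep.dimVec x : ℝ) = excess α θ D.toRep.dimVec :=
    sum_mul_dimVec_sub_indicator (fun x => α x - θ) D
  rw [hsum, zero_mul, hD] at hharris
  have : Nonempty P := hne.to_subtype
  exact nonpos_of_mul_nonpos_right hharris (Nat.cast_pos.2 Fintype.card_pos)

end Convexity

section TwoVertices

variable {K : Type u} [Field K] {Q : Type w} [Quiver.{v} Q] {V : QuiverRep K Q}
  {p q : Q}

open Classical in
/-- The part of `V` supported on a set `U` of vertices which is closed under the edges. -/
noncomputable def restriction (V : QuiverRep K Q) (U : Set Q)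
    (hU : ∀ x y : Q, (x ⟶ y) → x ∈ U → y ∈ U) : Sub V where
  carrier x := if x ∈ U then ⊤ else ⊥
  map_mem {x y} e v hv := by
    by_cases hy : y ∈ U
    · rw [if_pos hy]
      exact Submodule.mem_top
    · rw [if_neg fun hx => hy (hU x y e hx), Submodule.mem_bot] at hv
      rw [hv, map_zero]
      exact Submodule.zero_mem _

theorem dimVec_restriction {U : Set Q} (hU : ∀ x y : Q, (x ⟶ y) → x ∈ U → y ∈ U) :
    (V.restriction U hU).toRep.dimVec = U.indicator V.dimVec := by
  classical
  funext x
  change Module.finrank K (if x ∈ U then ⊤ else ⊥ : Submodule K (V.obj x)) = _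
  by_cases hx : x ∈ U
  · rw [if_pos hx, Set.indicator_of_mem hx, finrank_top, dimVec]
  · rw [if_neg hx, Set.indicator_of_notMem hx, finrank_bot]

theorem not_isIsomorphic_directSum_indicator_singleton (e : p ⟶ q) (hpq : p ≠ q) :
    ¬(indicator K {p, q}).IsIsomorphic (directSum fun j => indicator K (![{p}, {q}] j)) := by
  rintro ⟨φ, hφ⟩
  have hnt : Nontrivial ((indicator K {p, q}).obj p) := by
    rw [← Module.finrank_pos_iff (R := K)]
    change 0 < (indicator K {p, q}).dimVec p
    rw [dimVec_indicator, Set.indicator_of_mem (Set.mem_insert p _)]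
    exact one_pos
  obtain ⟨v, hv⟩ := exists_ne (0 : (indicator K {p, q}).obj p)
  have hzero (j : Fin 2) : (indicator K (![{p}, {q}] j)).map e = 0 := by
    revert j
    exact Fin.forall_fin_two.2
      ⟨indicator_map_eq_zero e (.inr hpq.symm), indicator_map_eq_zero e (.inl hpq)⟩
  have hmap : (indicator K {p, q}).map e v = 0 := by
    rw [← (φ q).map_eq_zero_iff, hφ]
    exact funext fun j => LinearMap.congr_fun (hzero j) _
  have hq : q ∈ ({p, q} : Set Q) := Set.mem_insert_of_mem p rfl
  exact hv ((injective_iff_map_eq_zero _).1 (indicator_map_injective e hq) v hmap)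

variable [Fintype Q] {α : Q → ℝ}

theorem isSemistable_and_slope_eq_of_dimVec_eq_indicator_singleton
    (h : V.dimVec = ({q} : Set Q).indicator 1) : V.IsSemistable α ∧ V.slope α = α q := by
  have hexcess (D : Sub V) : excess α (α q) D.toRep.dimVec = 0 := by
    refine Finset.sum_eq_zero fun x _ => ?_
    rcases eq_or_ne x q with rfl | hx
    · rw [sub_self, zero_mul]
    · have hle := D.dimVec_le x
      rw [h, Set.indicator_of_notMem (Set.notMem_singleton_iff.2 hx)] at hle
      rw [Nat.le_zero.1 hle, Nat.cast_zero, mul_zero]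
  refine isSemistable_and_slope_eq_iff.2 ⟨?_, ?_, fun D => (hexcess D).le⟩
  · rw [isNonzero_iff_dimVec_ne_zero, h, ← dimVec_indicator (K := K),
      ← isNonzero_iff_dimVec_ne_zero, isNonzero_indicator_iff]
    exact Set.singleton_nonempty q
  · rw [← Sub.dimVec_top, hexcess]

theorem hnType_of_dimVec_eq_indicator_pair {U : Set Q}
    (hU : ∀ x y : Q, (x ⟶ y) → x ∈ U → y ∈ U) (hp : p ∉ U) (hq : q ∈ U)
    (h : V.dimVec = ({p, q} : Set Q).indicator 1) (hα : α p < α q) :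
    V.hnType α = [({q} : Set Q).indicator 1, ({p} : Set Q).indicator 1] := by
  let A : Sub V := V.restriction U hU
  have hA : A.toRep.dimVec = ({q} : Set Q).indicator 1 := by
    rw [dimVec_restriction, h, Set.indicator_indicator, Set.inter_insert_of_notMem hp,
      Set.inter_singleton_of_mem hq]
  have hbot : ((⊥ : Sub V).subquotient A).dimVec = ({q} : Set Q).indicator 1 := by
    rw [← hA, ← Sub.dimVec_subquotient_add bot_le, Sub.dimVec_bot, add_zero]
  have htop : (A.subquotient ⊤).dimVec = ({p} : Set Q).indicator 1 := by
    rw [← add_left_inj A.toRep.dimVec, Sub.dimVec_subquotient_add le_top, Sub.dimVec_top, h, hA,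
      Set.insert_eq, Set.indicator_union_of_disjoint
        (Set.disjoint_singleton.2 (ne_of_mem_of_not_mem hq hp).symm)]
    rfl
  obtain ⟨F, hF⟩ := HNFiltration.exists_type_eq (α := α) (step := ![⊥, A, ⊤])
    (s := ![α q, α p]) rfl rfl (Fin.forall_fin_two.2 ⟨bot_le, le_top⟩)
    (Fin.strictAnti_iff_succ_lt.2 (Fin.forall_fin_one.2 hα))
    (Fin.forall_fin_two.2 ⟨isSemistable_and_slope_eq_of_dimVec_eq_indicator_singleton hbot,
      isSemistable_and_slope_eq_of_dimVec_eq_indicator_singleton htop⟩)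
  rw [F.hnType_eq_type, hF]
  exact congrArg₂ (fun δ ε => [δ, ε]) hbot htop

end TwoVertices

end QuiverRep

namespace Grid

open QuiverRep

variable {d : ℕ} {ℓ : Fin d → ℕ}

noncomputable instance : DistribLattice (Grid ℓ) :=
  inferInstanceAs (DistribLattice (∀ i, Fin (ℓ i + 1)))

theorem nonempty_hom_iff_covBy {p q : Grid ℓ} : Nonempty (p ⟶ q) ↔ p ⋖ q := by
  refine Iff.trans ⟨fun ⟨⟨h⟩⟩ => h, fun h => ⟨⟨h⟩⟩⟩ (Iff.trans ?_ Pi.covBy_iff.symm)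
  simp only [Fin.covBy_iff, Nat.covBy_iff_add_one_eq, eq_comm]

theorem antitone_of_forall_hom {α : Grid ℓ → ℝ} (h : ∀ (p q : Grid ℓ) (_ : p ⟶ q), α p > α q) :
    Antitone α := by
  classical
  let _ : LocallyFiniteOrder (Grid ℓ) := Fintype.toLocallyFiniteOrder
  exact (antitone_iff_forall_covBy α).2 fun p q hpq =>
    let ⟨e⟩ := nonempty_hom_iff_covBy.2 hpq
    (h p q e).le

theorem isRectangle_iff_exists_Icc {R : Set (Grid ℓ)} :
    IsRectangle R ↔ ∃ a b : Grid ℓ, a ≤ b ∧ R = Set.Icc a b := by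
  have hIcc (a b : Grid ℓ) : Set.Icc a b = {p | ∀ i, a i ≤ p i ∧ p i ≤ b i} :=
    Set.ext fun _ => forall_and.symm
  simp only [hIcc]
  rfl

theorem isRectangle_singleton (p : Grid ℓ) : IsRectangle {p} :=
  isRectangle_iff_exists_Icc.2 ⟨p, p, le_rfl, (Set.Icc_self p).symm⟩

theorem isRectangle_pair {p q : Grid ℓ} (h : p ⋖ q) : IsRectangle {p, q} :=
  isRectangle_iff_exists_Icc.2 ⟨p, q, h.le, h.Icc_eq.symm⟩

variable {K : Type u} [Field K] {α : Grid ℓ → ℝ}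

theorem IsRectangle.isSemistable_indicator {R : Set (Grid ℓ)} (hR : IsRectangle R)
    (hα : Antitone α) : (indicator K R).IsSemistable α := by
  obtain ⟨a, b, hab, rfl⟩ := isRectangle_iff_exists_Icc.1 hR
  let P : Sublattice (Grid ℓ) :=
    { carrier := Set.Icc a b
      supClosed' := fun _ hx _ hy => ⟨hx.1.trans le_sup_left, sup_le hx.2 hy.2⟩
      infClosed' := fun _ hx _ hy => ⟨le_inf hx.1 hy.1, inf_le_left.trans hx.2⟩ }
  exact isSemistable_indicator_of_antitone (fun _ _ => nonempty_hom_iff_covBy.2) (P := P)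
    Set.ordConnected_Icc (Set.nonempty_Icc.2 hab) hα

theorem isComplete_of_antitone (hα : α ∉ hyperplanes K ℓ) (hanti : Antitone α) :
    IsComplete {α} (rectangleDecomposable K ℓ) := by
  rintro V ⟨n, R, hR, hV⟩ W ⟨m, S, hS, hW⟩ h
  let I (R : {R : Set (Grid ℓ) // IsRectangle R}) : QuiverRep K (Grid ℓ) := indicator K R.1
  have hslope : Function.Injective fun R => (I R).slope α := fun R R' heq =>
    Subtype.ext (by_contra fun hne => hα ⟨R, R', R.2, R'.2, hne, heq⟩)
  have hsum := isIsomorphic_directSum_of_hnType_eq (V := I)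
    (fun R => R.2.isSemistable_indicator hanti) hslope (r := fun j => ⟨R j, hR j⟩)
    (s := fun j => ⟨S j, hS j⟩)
    ((hV.hnType_eq α).symm.trans ((h α rfl).trans (hW.hnType_eq α)))
  exact (hV.trans hsum).trans hW.symm

theorem apply_ne_of_hom (hα : α ∉ hyperplanes K ℓ) {p q : Grid ℓ} (e : p ⟶ q) : α p ≠ α q := by
  have hslope (x : Grid ℓ) : (indicator K {x}).slope α = α x :=
    (isSemistable_and_slope_eq_of_dimVec_eq_indicator_singleton (dimVec_indicator {x})).2
  refine fun heq => hα ⟨{p}, {q}, isRectangle_singleton p, isRectangle_singleton q, ?_, ?_⟩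
  · exact Set.singleton_injective.ne (nonempty_hom_iff_covBy.1 ⟨e⟩).ne
  · rw [hslope, hslope, heq]

theorem not_isComplete_of_lt {p q : Grid ℓ} (e : p ⟶ q) (h : α p < α q) :
    ¬IsComplete {α} (rectangleDecomposable K ℓ) := by
  intro hcomplete
  have hpq : p ⋖ q := nonempty_hom_iff_covBy.1 ⟨e⟩
  let I : QuiverRep K (Grid ℓ) := indicator K {p, q}
  let S : QuiverRep K (Grid ℓ) := directSum fun j => indicator K (![{p}, {q}] j)
  have hI : I ∈ rectangleDecomposable K ℓ :=
    ⟨1, fun _ => {p, q}, fun _ => isRectangle_pair hpq, isIsomorphic_directSum_const I⟩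
  have hS : S ∈ rectangleDecomposable K ℓ :=
    ⟨2, ![{p}, {q}], Fin.forall_fin_two.2 ⟨isRectangle_singleton p, isRectangle_singleton q⟩,
      IsIsomorphic.refl S⟩
  have hdim : S.dimVec = ({p, q} : Set (Grid ℓ)).indicator 1 := by
    rw [dimVec_directSum, Fin.sum_univ_two, dimVec_indicator, dimVec_indicator, Set.insert_eq,
      Set.indicator_union_of_disjoint (Set.disjoint_singleton.2 hpq.ne)]
    rfl
  have hU (x y : Grid ℓ) (e : x ⟶ y) (hx : x ∈ Set.Ici q) : y ∈ Set.Ici q :=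
    hx.trans (nonempty_hom_iff_covBy.1 ⟨e⟩).le
  refine not_isIsomorphic_directSum_indicator_singleton e hpq.ne (hcomplete I hI S hS ?_)
  rintro _ rfl
  rw [hnType_of_dimVec_eq_indicator_pair hU hpq.lt.not_ge Set.self_mem_Ici (dimVec_indicator _) h,
    hnType_of_dimVec_eq_indicator_pair hU hpq.lt.not_ge Set.self_mem_Ici hdim h]

end Grid

theorem theorem5p9 {K : Type*} [Field K] {d : ℕ} (ℓ : Fin d → ℕ) (hℓ : ∀ i, 1 ≤ ℓ i)
    (α : Grid ℓ → ℝ) (hα : α ∉ Grid.hyperplanes K ℓ) :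
    QuiverRep.IsComplete {α} (Grid.rectangleDecomposable K ℓ) ↔
      ∀ (p q : Grid ℓ) (_ : p ⟶ q), α p > α q := by
  refine ⟨fun hcomplete p q e => ?_, fun hdec =>
    Grid.isComplete_of_antitone hα (Grid.antitone_of_forall_hom hdec)⟩
  have hle : α q ≤ α p := not_lt.1 fun hlt => Grid.not_isComplete_of_lt e hlt hcomplete
  exact hle.lt_of_ne (Grid.apply_ne_of_hom hα e).symm
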